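/- **Theorem 3.8 (First correspondence theorem).** Let $(\mathcal C,\mathbb E,\mathfrak s)$ be an extriangulated category (in the sense of Nakaoka–Palu) with higher extension groups: either $\mathcal C$ is abelian or triangulated, with its usual extriangulated structure, and $\mathbb E^k(X,Y)$ ($k\ge 1$) is $\mathrm{Ext}^k_{\mathcal C}(X,Y)$, respectively $\mathrm{Hom}_{\mathcal C}(X,Y[k])$; or $\mathcal C$ has enough $\mathbb E$-projectives and enough $\mathbb E$-injectives, and $\mathbb E^{k+1}(X,Y)=\mathbb E(X,\Sigma^kY)$ for $k\ge 0$, where $\Sigma^k Y$ is a $k$-th cosyzygy of $Y$ (that is, $\Sigma^0Y=Y$ and there are conflations $\Sigma^{k}Y\to I_k\to\Sigma^{k+1}Y$ with $I_k$ $\mathbb E$-injective). Below, calligraphic letters and $\omega$ denote classes of objects of $\mathcal C$. A class $\mathcal X$ is *closed under extensions* (*cones*, *cocones*) if for every conflation $A\to B\to C$ with $A,C\in\mathcal X$ (with $A,B\in\mathcal X$, with $B,C\in\mathcal X$) one has $B\in\mathcal X$ ($C\in\mathcal X$, $A\in\mathcal X$). It is *closed under direct summands* if $A\oplus B\simeq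 M\in\mathcal X$ implies $A,B\in\mathcal X$. It is *left thick* (*right thick*) if it is closed under extensions, direct summands and cocones (cones). The class $\mathcal X^\wedge$ consists of the objects $M$ having a finite $\mathcal X$-resolution: define $\mathcal X^\wedge_{(0)}$ as the class of objects isomorphic to an object of $\mathcal X$, let $M\in\mathcal X^\wedge_{(n+1)}$ if there is a conflation $K\to X\to M$ with $X\in\mathcal X$ and $K\in\mathcal X^\wedge_{(n)}$, and put $\mathcal X^\wedge=\bigcup_{n\ge 0}\mathcal X^\wedge_{(n)}$. The class $\omega$ is a *relative cogenerator* (*relative generator*) in $\mathcal X$ if $\omega\subseteq\mathcal X$ and for each $X\in\mathcal X$ there is a conflation $X\to W\to X'$ (respectively $X'\to W\to X$) with $W\in\omega$ and $X'\in\mathcal X$. It is *$\mathcal X$-injective* (*$\mathcal X$-projective*) if $\mathrm{id}_{\mathcal X}(\omega)=0$ (respectively $\mathrm{pd}_{\mathcal X}(\omega)=0$), i.e. $\mathbb E^k(X,W)=0$ (respectively $\mathbb E^k(W,X)=0$) for all $k\ge1$, $X\in\mathcal X$, $W\in\omega$. A pair $(\mathcal X,\omega)$ is a *left Frobenius pair*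 if $\mathcal X$ is left thick, $\omega$ is closed under direct summands, and $\omega$ is an $\mathcal X$-injective relative cogenerator in $\mathcal X$. It is a *left Frobenius pair cut on $\mathcal S$* if 1. $\mathcal X$ is left thick; 2. $(\mathcal X\cap\mathcal S,\omega\cap\mathcal S)$ is a left Frobenius pair; 3. $\omega\cap\mathcal S$ is $\omega$-projective and a relative generator in $\omega$; 4. $\omega$ is closed under extensions and direct summands. A pair $(\mathcal A,\mathcal B)$ is a *left weak Auslander–Buchweitz context cut on $\mathcal S$* if $(\mathcal A,\mathcal A\cap\mathcal B)$ is a left Frobenius pair cut on $\mathcal S$, $\mathcal B\cap\mathcal S$ is right thick, and $\mathcal B\cap\mathcal S\subseteq(\mathcal A\cap\mathcal S)^\wedge$. Let $\mathfrak F_{\mathcal S}$ and $\mathfrak C_{\mathcal S}$ be the classes of the left Frobenius pairs, respectively of the left weak Auslander–Buchweitz contexts, cut on $\mathcal S$. On $\mathfrak F_{\mathcal S}$ put $(\mathcal X,\omega)\sim(\mathcal X',\omega')$ if $\mathcal X\cap\mathcal S=\mathcal X'\cap\mathcal S$ and $\omega\cap\mathcal S=\omega'\cap\mathcal S$. On $\mathfrak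 C_{\mathcal S}$ put $(\mathcal A,\mathcal B)\sim(\mathcal A',\mathcal B')$ if $\mathcal A\cap\mathcal S=\mathcal A'\cap\mathcal S$ and $\mathcal A\cap\mathcal B\cap\mathcal S=\mathcal A'\cap\mathcal B'\cap\mathcal S$. Suppose that $\mathcal S$ is closed under cones and cocones. Then $$\Phi_{\mathcal S}\colon \mathfrak F_{\mathcal S}/\!\sim\;\longrightarrow\;\mathfrak C_{\mathcal S}/\!\sim,\qquad [\mathcal X,\omega]\longmapsto[\mathcal X,\omega^\wedge],$$ is well defined (in particular $(\mathcal X,\omega^\wedge)\in\mathfrak C_{\mathcal S}$ for every $(\mathcal X,\omega)\in\mathfrak F_{\mathcal S}$) and bijective, and its inverse is well defined and given by $[\mathcal A,\mathcal B]\mapsto[\mathcal A,\mathcal A\cap\mathcal B]$. -/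

import Mathlib

open CategoryTheory CategoryTheory.Limits

universe w v u

/-! ## Extriangulated categories -/

/-- A sequence of morphisms `A ⟶ mid ⟶ B` with fixed ends. -/
structure TwoStepSeq {C : Type u} [Category.{v} C] (A B : C) where
  mid : C
  f : A ⟶ mid
  g : mid ⟶ B

/-- Two sequences with the same ends are equivalent if there is an isomorphism between their
middle terms that is compatible with the morphisms from `A` and to `B`. -/
def twoStepSetoid {C : Type u} [Category.{v} C] (A B : C) : Setoid (TwoStepSeq A B) where
  r s t := ∃ b : s.mid ≅ t.mid, s.f ≫ b.hom = t.f ∧ b.hom ≫ t.g = s.g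
  iseqv :=
    { refl := fun s => ⟨Iso.refl _, by simp, by simp⟩
      symm := by
        rintro s t ⟨b, h₁, h₂⟩
        exact ⟨b.symm, by simp [← h₁], by simp [← h₂]⟩
      trans := by
        rintro s t r ⟨b, h₁, h₂⟩ ⟨c, h₃, h₄⟩
        exact ⟨b ≪≫ c, by simp [← h₁, ← h₃], by simp [h₂, h₄]⟩ }

/-- The equivalence class `[A ⟶ B ⟶ D]`. -/
def seqClass {C : Type u} [Category.{v} C] {A B D : C} (x : A ⟶ B) (y : B ⟶ D) :
    Quotient (twoStepSetoid A D) :=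
  Quotient.mk (twoStepSetoid A D) ⟨B, x, y⟩

/-- For `δ ∈ E(D, A)` and `a : A ⟶ A'`, the extension `aδ = E(D, a)(δ) ∈ E(D, A')`. -/
def extPush {C : Type u} [Category.{v} C] (E : Cᵒᵖ ⥤ C ⥤ AddCommGrpCat.{w}) {D A A' : C}
    (a : A ⟶ A') (δ : (E.obj (Opposite.op D)).obj A) : (E.obj (Opposite.op D)).obj A' :=
  (E.obj (Opposite.op D)).map a δ

/-- For `δ ∈ E(D, A)` and `c : D' ⟶ D`, the extension `δc = E(c, A)(δ) ∈ E(D', A)`. -/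
def extPull {C : Type u} [Category.{v} C] (E : Cᵒᵖ ⥤ C ⥤ AddCommGrpCat.{w}) {D D' A : C}
    (c : D' ⟶ D) (δ : (E.obj (Opposite.op D)).obj A) : (E.obj (Opposite.op D')).obj A :=
  (E.map c.op).app A δ

/-- The direct sum `δ ⊕ δ' ∈ E(D ⊞ D', A ⊞ A')` of two extensions: the element with components
`(δ, 0, 0, δ')` in `E(D, A) ⊕ E(D, A') ⊕ E(D', A) ⊕ E(D', A')`. -/
noncomputable def extSum {C : Type u} [Category.{v} C] [Preadditive C] [HasBinaryBiproducts C]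
    (E : Cᵒᵖ ⥤ C ⥤ AddCommGrpCat.{w}) {D A D' A' : C}
    (δ : (E.obj (Opposite.op D)).obj A) (δ' : (E.obj (Opposite.op D')).obj A') :
    (E.obj (Opposite.op (D ⊞ D'))).obj (A ⊞ A') :=
  extPush E biprod.inl (extPull E biprod.fst δ) + extPush E biprod.inr (extPull E biprod.snd δ')

/-- An external triangulation `(E, s)` (with values `E(D, A)` in abelian groups of universe level
`w`) of an additive category `C`. In all axioms, `s δ = seqClass x y` says that
`A ⟶ B ⟶ D` realizes `δ ∈ E(D, A)`. -/
structure Extriangulation (C : Type u) [Category.{v} C] [Preadditive C] [HasZeroObject C]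
    [HasBinaryBiproducts C] where
  /-- The bifunctor `E : Cᵒᵖ × C → Ab`. -/
  E : Cᵒᵖ ⥤ C ⥤ AddCommGrpCat.{w}
  additive_right : ∀ D : Cᵒᵖ, (E.obj D).Additive
  additive_left : E.Additive
  /-- The realization. -/
  s : ∀ {D A : C}, (E.obj (Opposite.op D)).obj A → Quotient (twoStepSetoid A D)
  /-- Morphisms of extensions are realized. -/
  realization : ∀ {A B D A' B' D' : C} (x : A ⟶ B) (y : B ⟶ D) (x' : A' ⟶ B') (y' : B' ⟶ D')
    (δ : (E.obj (Opposite.op D)).obj A) (δ' : (E.obj (Opposite.op D')).obj A'),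
    s δ = seqClass x y → s δ' = seqClass x' y' →
    ∀ (a : A ⟶ A') (c : D ⟶ D'), extPush E a δ = extPull E c δ' →
      ∃ b : B ⟶ B', x ≫ b = a ≫ x' ∧ y ≫ c = b ≫ y'
  /-- The zero extension is realized by the split sequence. -/
  s_zero : ∀ A D : C, s (0 : (E.obj (Opposite.op D)).obj A) =
    seqClass (biprod.inl : A ⟶ A ⊞ D) (biprod.snd : A ⊞ D ⟶ D)
  /-- The realization is compatible with direct sums. -/
  s_sum : ∀ {A B D A' B' D' : C} (x : A ⟶ B) (y : B ⟶ D) (x' : A' ⟶ B') (y' : B' ⟶ D')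
    (δ : (E.obj (Opposite.op D)).obj A) (δ' : (E.obj (Opposite.op D')).obj A'),
    s δ = seqClass x y → s δ' = seqClass x' y' →
      s (extSum E δ δ') = seqClass (biprod.map x x') (biprod.map y y')
  /-- (ET3) -/
  et3 : ∀ {A B D A' B' D' : C} (x : A ⟶ B) (y : B ⟶ D) (x' : A' ⟶ B') (y' : B' ⟶ D')
    (δ : (E.obj (Opposite.op D)).obj A) (δ' : (E.obj (Opposite.op D')).obj A'),
    s δ = seqClass x y → s δ' = seqClass x' y' →
    ∀ (a : A ⟶ A') (b : B ⟶ B'), x ≫ b = a ≫ x' →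
      ∃ c : D ⟶ D', extPush E a δ = extPull E c δ' ∧ y ≫ c = b ≫ y'
  /-- (ET3)ᵒᵖ -/
  et3_op : ∀ {A B D A' B' D' : C} (x : A ⟶ B) (y : B ⟶ D) (x' : A' ⟶ B') (y' : B' ⟶ D')
    (δ : (E.obj (Opposite.op D)).obj A) (δ' : (E.obj (Opposite.op D')).obj A'),
    s δ = seqClass x y → s δ' = seqClass x' y' →
    ∀ (b : B ⟶ B') (c : D ⟶ D'), y ≫ c = b ≫ y' →
      ∃ a : A ⟶ A', extPush E a δ = extPull E c δ' ∧ x ≫ b = a ≫ x'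
  /-- (ET4) -/
  et4 : ∀ {A B D G F : C} (f : A ⟶ B) (f' : B ⟶ D) (g : B ⟶ G) (g' : G ⟶ F)
    (δ : (E.obj (Opposite.op D)).obj A) (δ' : (E.obj (Opposite.op F)).obj B),
    s δ = seqClass f f' → s δ' = seqClass g g' →
      ∃ (H : C) (h' : G ⟶ H) (d : D ⟶ H) (e : H ⟶ F) (δ'' : (E.obj (Opposite.op H)).obj A),
        f' ≫ d = g ≫ h' ∧ h' ≫ e = g' ∧
        s δ'' = seqClass (f ≫ g) h' ∧
        s (extPush E f' δ') = seqClass d e ∧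
        extPull E d δ'' = δ ∧ extPush E f δ'' = extPull E e δ'
  /-- (ET4)ᵒᵖ -/
  et4_op : ∀ {D A B F G : C} (f' : D ⟶ A) (f : A ⟶ B) (g' : F ⟶ B) (g : B ⟶ G)
    (δ : (E.obj (Opposite.op B)).obj D) (δ' : (E.obj (Opposite.op G)).obj F),
    s δ = seqClass f' f → s δ' = seqClass g' g →
      ∃ (H : C) (h' : H ⟶ A) (d : D ⟶ H) (e : H ⟶ F) (δ'' : (E.obj (Opposite.op G)).obj H),
        d ≫ h' = f' ∧ h' ≫ f = e ≫ g' ∧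
        s δ'' = seqClass h' (f ≫ g) ∧
        s (extPull E g' δ) = seqClass d e ∧
        δ' = extPush E e δ'' ∧ extPush E d δ = extPull E g δ''

namespace Extriangulation

section

variable {C : Type u} [Category.{v} C] [Preadditive C] [HasZeroObject C] [HasBinaryBiproducts C]

/-- `A ⟶ B ⟶ D` is a conflation if it realizes some extension. Equivalently, it can be completed
to an `E`-triangle `A ⟶ B ⟶ D ⇢`. -/
def Conflation (T : Extriangulation.{w} C) {A B D : C} (x : A ⟶ B) (y : B ⟶ D) : Prop :=
  ∃ δ : (T.E.obj (Opposite.op D)).obj A, T.s δ = seqClass x y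

/-- `E`-projective objects. -/
def IsEProjective (T : Extriangulation.{w} C) (P : C) : Prop :=
  ∀ ⦃A B D : C⦄ (x : A ⟶ B) (y : B ⟶ D), T.Conflation x y →
    ∀ p : P ⟶ D, ∃ q : P ⟶ B, q ≫ y = p

/-- `E`-injective objects. -/
def IsEInjective (T : Extriangulation.{w} C) (I : C) : Prop :=
  ∀ ⦃A B D : C⦄ (x : A ⟶ B) (y : B ⟶ D), T.Conflation x y →
    ∀ p : A ⟶ I, ∃ q : B ⟶ I, x ≫ q = p

def EnoughEProjectives (T : Extriangulation.{w} C) : Prop :=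
  ∀ Y : C, ∃ (K P : C) (x : K ⟶ P) (y : P ⟶ Y), T.IsEProjective P ∧ T.Conflation x y

def EnoughEInjectives (T : Extriangulation.{w} C) : Prop :=
  ∀ Y : C, ∃ (Z I : C) (x : Y ⟶ I) (y : I ⟶ Z), T.IsEInjective I ∧ T.Conflation x y

/-- A chosen cosyzygy `ΣY`, sitting in a conflation `Y ⟶ I ⟶ ΣY` with `I` an `E`-injective
object. -/
noncomputable def cosyzygy (T : Extriangulation.{w} C) (hi : T.EnoughEInjectives) (Y : C) : C :=
  (hi Y).choose

/-- The iterated cosyzygy `Σᵏ Y`. -/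
noncomputable def cosyzygyIter (T : Extriangulation.{w} C) (hi : T.EnoughEInjectives) :
    ℕ → C → C
  | 0, Y => Y
  | k + 1, Y => T.cosyzygy hi (T.cosyzygyIter hi k Y)

end

/-- The data that make `(C, E, s)` an extriangulated category with higher extension groups: it is
an abelian category, or a triangulated category (with the usual extriangulated structures), or it
has enough `E`-projectives and enough `E`-injectives. -/
inductive HigherExtData {C : Type u} [Category.{v} C] [Preadditive C] [HasZeroObject C]
    [HasBinaryBiproducts C] (T : Extriangulation.{w} C) : Type (max u v w)
  /-- `C` is abelian and the conflations are the short exact sequences. (As the kernels and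
  cokernels are monic and epic, an extension is then determined by the sequence that realizes it,
  so this forces `E` to be the bifunctor `Ext¹` and `s` to be its usual realization.) -/
  | abelian (hk : HasKernels C) (hc : HasCokernels C) (hm : IsNormalMonoCategory C)
      (he : IsNormalEpiCategory C)
      (conflation_iff : ∀ {A B D : C} (x : A ⟶ B) (y : B ⟶ D),
        T.Conflation x y ↔ ∃ h : x ≫ y = 0, (ShortComplex.mk x y h).ShortExact)
  /-- `C` is triangulated, `E(D, A)` is `Hom(D, A⟦1⟧)`, naturally in `D` and `A`, and
  `A ⟶ B ⟶ D` realizes `δ` if and only if `A ⟶ B ⟶ D ⟶ A⟦1⟧`, with last morphism `δ`, is a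
  distinguished triangle. -/
  | triangulated [HasShift C ℤ] [∀ n : ℤ, (shiftFunctor C n).Additive] [Pretriangulated C]
      [IsTriangulated C]
      (φ : ∀ D A : C, (T.E.obj (Opposite.op D)).obj A ≃+ (D ⟶ (shiftFunctor C (1 : ℤ)).obj A))
      (φ_push : ∀ {D A A' : C} (a : A ⟶ A') (δ : (T.E.obj (Opposite.op D)).obj A),
        φ D A' (extPush T.E a δ) = φ D A δ ≫ (shiftFunctor C (1 : ℤ)).map a)
      (φ_pull : ∀ {D D' A : C} (c : D' ⟶ D) (δ : (T.E.obj (Opposite.op D)).obj A),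
        φ D' A (extPull T.E c δ) = c ≫ φ D A δ)
      (realizes_iff : ∀ {A B D : C} (x : A ⟶ B) (y : B ⟶ D)
        (δ : (T.E.obj (Opposite.op D)).obj A),
        T.s δ = seqClass x y ↔
          Pretriangulated.Triangle.mk x y (φ D A δ) ∈ Pretriangulated.distinguishedTriangles)
  /-- There are enough `E`-projectives and enough `E`-injectives. -/
  | enough (hp : T.EnoughEProjectives) (hi : T.EnoughEInjectives)

section

variable {C : Type u} [Category.{v} C] [Preadditive C] [HasZeroObject C] [HasBinaryBiproducts C]

/-- The higher extension groups `Eᵏ(X, Y)` (`k ≥ 1`): the groups `Extᵏ(X, Y)` in the abelian case,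
`Hom(X, Y⟦k⟧)` in the triangulated case, and `E(X, Σᵏ⁻¹ Y)` if there are enough `E`-projectives
and `E`-injectives. (For `k = 0`, which is not used, this is `Hom(X, Y)` in all three cases.) -/
noncomputable def higherExt {T : Extriangulation.{w} C} (h : T.HigherExtData) (k : ℕ) (X Y : C) :
    AddCommGrpCat.{max u v w} :=
  match h, k with
  | .abelian _ _ _ _ _, k =>
      letI : HasFiniteProducts C := hasFiniteProducts_of_has_binary_and_terminal
      letI : Abelian C := {}
      haveI : HasExt.{max u v} C := HasExt.standard C
      AddCommGrpCat.of (ULift.{w} (Abelian.Ext.{max u v} X Y k))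
  | @HigherExtData.triangulated _ _ _ _ _ _ _ _ _ _ _ _ _ _, k =>
      AddCommGrpCat.of (ULift.{max u w} (X ⟶ (shiftFunctor C (k : ℤ)).obj Y))
  | .enough _ _, 0 => AddCommGrpCat.of (ULift.{max u w} (X ⟶ Y))
  | .enough _ hi, k + 1 =>
      AddCommGrpCat.of (ULift.{max u v} ((T.E.obj (Opposite.op X)).obj (T.cosyzygyIter hi k Y)))

/-- `Eᵏ(𝒳, 𝒴) = 0` for all `k ≥ n`. -/
def ExtVanishesFrom {T : Extriangulation.{w} C} (h : T.HigherExtData) (n : ℕ)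
    (𝒳 𝒴 : ObjectProperty C) : Prop :=
  ∀ k ≥ n, ∀ X Y : C, 𝒳 X → 𝒴 Y → Subsingleton (higherExt h k X Y)

/-- The relative projective dimension `pd_𝒳(M)` of an object. -/
noncomputable def relPdObj {T : Extriangulation.{w} C} (h : T.HigherExtData) (𝒳 : ObjectProperty C)
    (M : C) : ℕ∞ :=
  ⨅ (m : ℕ) (_ : ExtVanishesFrom h (m + 1) (fun N => N = M) 𝒳), (m : ℕ∞)

/-- The relative projective dimension `pd_𝒳(𝒴)` of a class of objects. -/
noncomputable def relPd {T : Extriangulation.{w} C} (h : T.HigherExtData)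
    (𝒳 𝒴 : ObjectProperty C) : ℕ∞ :=
  ⨆ (M : C) (_ : 𝒴 M), relPdObj h 𝒳 M

/-- The relative injective dimension `id_𝒳(M)` of an object. -/
noncomputable def relIdObj {T : Extriangulation.{w} C} (h : T.HigherExtData) (𝒳 : ObjectProperty C)
    (M : C) : ℕ∞ :=
  ⨅ (m : ℕ) (_ : ExtVanishesFrom h (m + 1) 𝒳 (fun N => N = M)), (m : ℕ∞)

/-- The relative injective dimension `id_𝒳(𝒴)` of a class of objects. -/
noncomputable def relId {T : Extriangulation.{w} C} (h : T.HigherExtData)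
    (𝒳 𝒴 : ObjectProperty C) : ℕ∞ :=
  ⨆ (M : C) (_ : 𝒴 M), relIdObj h 𝒳 M

/-! ## Closure properties, resolutions and relative (co)generators -/

def ClosedUnderExtensions (T : Extriangulation.{w} C) (𝒳 : ObjectProperty C) : Prop :=
  ∀ ⦃A B D : C⦄ (x : A ⟶ B) (y : B ⟶ D), T.Conflation x y → 𝒳 A → 𝒳 D → 𝒳 B

def ClosedUnderCones (T : Extriangulation.{w} C) (𝒳 : ObjectProperty C) : Prop :=
  ∀ ⦃A B D : C⦄ (x : A ⟶ B) (y : B ⟶ D), T.Conflation x y → 𝒳 A → 𝒳 B → 𝒳 D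

def ClosedUnderCocones (T : Extriangulation.{w} C) (𝒳 : ObjectProperty C) : Prop :=
  ∀ ⦃A B D : C⦄ (x : A ⟶ B) (y : B ⟶ D), T.Conflation x y → 𝒳 B → 𝒳 D → 𝒳 A

/-- If `M ≅ A ⊞ B` is in the class, so is `A` (hence, by symmetry, `B`). -/
def _root_.CategoryTheory.ObjectProperty.ClosedUnderSummands (𝒳 : ObjectProperty C) : Prop :=
  ∀ ⦃M A B : C⦄, Nonempty (M ≅ A ⊞ B) → 𝒳 M → 𝒳 A

def IsLeftThick (T : Extriangulation.{w} C) (𝒳 : ObjectProperty C) : Prop :=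
  T.ClosedUnderExtensions 𝒳 ∧ 𝒳.ClosedUnderSummands ∧ T.ClosedUnderCocones 𝒳

def IsRightThick (T : Extriangulation.{w} C) (𝒳 : ObjectProperty C) : Prop :=
  T.ClosedUnderExtensions 𝒳 ∧ 𝒳.ClosedUnderSummands ∧ T.ClosedUnderCones 𝒳

/-- `M` has a finite `𝒳`-resolution `0 ⟶ X_n ⟶ ⋯ ⟶ X_0 ⟶ M ⟶ 0` of length `n`, obtained by
splicing conflations. -/
inductive HasResolution (T : Extriangulation.{w} C) (𝒳 : ObjectProperty C) : ℕ → C → Prop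
  | zero {X M : C} (hX : 𝒳 X) (e : X ≅ M) : HasResolution T 𝒳 0 M
  | succ {n : ℕ} {K X M : C} (x : K ⟶ X) (y : X ⟶ M) (hxy : T.Conflation x y) (hX : 𝒳 X)
      (hK : HasResolution T 𝒳 n K) : HasResolution T 𝒳 (n + 1) M

/-- The class `𝒳^∧` of the objects of finite `𝒳`-resolution dimension. -/
def hat (T : Extriangulation.{w} C) (𝒳 : ObjectProperty C) : ObjectProperty C :=
  fun M => ∃ n : ℕ, T.HasResolution 𝒳 n M

/-- `ω` is a relative cogenerator in `𝒳`. -/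
def IsRelCogenerator (T : Extriangulation.{w} C) (ω 𝒳 : ObjectProperty C) : Prop :=
  ω ≤ 𝒳 ∧ ∀ X : C, 𝒳 X → ∃ (W X' : C) (x : X ⟶ W) (y : W ⟶ X'),
    T.Conflation x y ∧ ω W ∧ 𝒳 X'

/-- `ω` is a relative generator in `𝒳`. -/
def IsRelGenerator (T : Extriangulation.{w} C) (ω 𝒳 : ObjectProperty C) : Prop :=
  ω ≤ 𝒳 ∧ ∀ X : C, 𝒳 X → ∃ (X' W : C) (x : X' ⟶ W) (y : W ⟶ X),
    T.Conflation x y ∧ ω W ∧ 𝒳 X'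

/-! ## Frobenius pairs and Auslander–Buchweitz contexts -/

/-- Left Frobenius pairs in `C`. -/
structure IsLeftFrobenius {T : Extriangulation.{w} C} (h : T.HigherExtData)
    (𝒳 ω : ObjectProperty C) : Prop where
  leftThick : T.IsLeftThick 𝒳
  summands : ω.ClosedUnderSummands
  injective : relId h 𝒳 ω = 0
  cogenerator : T.IsRelCogenerator ω 𝒳

/-- Left Frobenius pairs cut on `𝒮`. -/
structure IsCutLeftFrobenius {T : Extriangulation.{w} C} (h : T.HigherExtData)
    (𝒮 𝒳 ω : ObjectProperty C) : Prop where
  leftThick : T.IsLeftThick 𝒳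
  frobenius : IsLeftFrobenius h (𝒳 ⊓ 𝒮) (ω ⊓ 𝒮)
  projective : relPd h ω (ω ⊓ 𝒮) = 0
  generator : T.IsRelGenerator (ω ⊓ 𝒮) ω
  extensions : T.ClosedUnderExtensions ω
  summands : ω.ClosedUnderSummands

/-- Left weak Auslander–Buchweitz contexts cut on `𝒮`. -/
structure IsCutLeftWeakABContext {T : Extriangulation.{w} C} (h : T.HigherExtData)
    (𝒮 𝒜 ℬ : ObjectProperty C) : Prop where
  frobenius : IsCutLeftFrobenius h 𝒮 𝒜 (𝒜 ⊓ ℬ)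
  rightThick : T.IsRightThick (ℬ ⊓ 𝒮)
  le_hat : ℬ ⊓ 𝒮 ≤ T.hat (𝒜 ⊓ 𝒮)

/-- The class `𝔉_𝒮` of left Frobenius pairs cut on `𝒮`. -/
@[ext]
structure CutFrobeniusPair {T : Extriangulation.{w} C} (h : T.HigherExtData)
    (𝒮 : ObjectProperty C) where
  fst : ObjectProperty C
  snd : ObjectProperty C
  prop : IsCutLeftFrobenius h 𝒮 fst snd

/-- The class `ℭ_𝒮` of left weak Auslander–Buchweitz contexts cut on `𝒮`. -/
@[ext]
structure CutABContext {T : Extriangulation.{w} C} (h : T.HigherExtData)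
    (𝒮 : ObjectProperty C) where
  fst : ObjectProperty C
  snd : ObjectProperty C
  prop : IsCutLeftWeakABContext h 𝒮 fst snd

/-- `(𝒳, ω) ∼ (𝒳', ω')` if `𝒳 ∩ 𝒮 = 𝒳' ∩ 𝒮` and `ω ∩ 𝒮 = ω' ∩ 𝒮`. -/
instance cutFrobeniusSetoid {T : Extriangulation.{w} C} (h : T.HigherExtData)
    (𝒮 : ObjectProperty C) : Setoid (CutFrobeniusPair h 𝒮) where
  r p q := p.fst ⊓ 𝒮 = q.fst ⊓ 𝒮 ∧ p.snd ⊓ 𝒮 = q.snd ⊓ 𝒮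
  iseqv :=
    { refl := fun _ => ⟨rfl, rfl⟩
      symm := fun hpq => ⟨hpq.1.symm, hpq.2.symm⟩
      trans := fun hpq hqr => ⟨hpq.1.trans hqr.1, hpq.2.trans hqr.2⟩ }

/-- `(𝒜, ℬ) ∼ (𝒜', ℬ')` if `𝒜 ∩ 𝒮 = 𝒜' ∩ 𝒮` and `𝒜 ∩ ℬ ∩ 𝒮 = 𝒜' ∩ ℬ' ∩ 𝒮`. -/
instance cutABSetoid {T : Extriangulation.{w} C} (h : T.HigherExtData)
    (𝒮 : ObjectProperty C) : Setoid (CutABContext h 𝒮) where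
  r p q := p.fst ⊓ 𝒮 = q.fst ⊓ 𝒮 ∧ p.fst ⊓ p.snd ⊓ 𝒮 = q.fst ⊓ q.snd ⊓ 𝒮
  iseqv :=
    { refl := fun _ => ⟨rfl, rfl⟩
      symm := fun hpq => ⟨hpq.1.symm, hpq.2.symm⟩
      trans := fun hpq hqr => ⟨hpq.1.trans hqr.1, hpq.2.trans hqr.2⟩ }

end

end Extriangulation

namespace Extriangulation

open scoped ZeroObject

variable {C : Type u} [Category.{v} C]

theorem seqClass_eq {A B B' D : C} {x : A ⟶ B} {y : B ⟶ D} {x' : A ⟶ B'} {y' : B' ⟶ D}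
    (e : B ≅ B') (h₁ : x ≫ e.hom = x') (h₂ : e.hom ≫ y' = y) : seqClass x y = seqClass x' y' :=
  Quotient.sound (s := twoStepSetoid A D) ⟨e, h₁, h₂⟩

theorem exists_iso_of_seqClass_eq {A B B' D : C} {x : A ⟶ B} {y : B ⟶ D} {x' : A ⟶ B'}
    {y' : B' ⟶ D} (h : seqClass x y = seqClass x' y') :
    ∃ e : B ≅ B', x ≫ e.hom = x' ∧ e.hom ≫ y' = y :=
  Quotient.exact (s := twoStepSetoid A D) h

section Bifunctor

variable (E : Cᵒᵖ ⥤ C ⥤ AddCommGrpCat.{w})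

@[simp] theorem extPush_zero {D A A' : C} (a : A ⟶ A') :
    extPush E a (0 : (E.obj (Opposite.op D)).obj A) = 0 :=
  map_zero ((E.obj (Opposite.op D)).map a).hom

@[simp] theorem extPull_zero {D D' A : C} (c : D' ⟶ D) :
    extPull E c (0 : (E.obj (Opposite.op D)).obj A) = 0 :=
  map_zero ((E.map c.op).app A).hom

theorem extPush_add {D A A' : C} (a : A ⟶ A') (δ δ' : (E.obj (Opposite.op D)).obj A) :
    extPush E a (δ + δ') = extPush E a δ + extPush E a δ' :=
  map_add ((E.obj (Opposite.op D)).map a).hom δ δ'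

@[simp] theorem extPush_id {D A : C} (δ : (E.obj (Opposite.op D)).obj A) :
    extPush E (𝟙 A) δ = δ := by
  simp [extPush]

@[simp] theorem extPull_id {D A : C} (δ : (E.obj (Opposite.op D)).obj A) :
    extPull E (𝟙 D) δ = δ := by
  simp [extPull]

theorem extPush_comp {D A A' A'' : C} (a : A ⟶ A') (a' : A' ⟶ A'')
    (δ : (E.obj (Opposite.op D)).obj A) :
    extPush E (a ≫ a') δ = extPush E a' (extPush E a δ) := by
  simp [extPush]

theorem extPull_comp {D D' D'' A : C} (c : D'' ⟶ D') (c' : D' ⟶ D)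
    (δ : (E.obj (Opposite.op D)).obj A) :
    extPull E (c ≫ c') δ = extPull E c (extPull E c' δ) := by
  simp [extPull]

theorem extPull_extPush {D D' A A' : C} (a : A ⟶ A') (c : D' ⟶ D)
    (δ : (E.obj (Opposite.op D)).obj A) :
    extPull E c (extPush E a δ) = extPush E a (extPull E c δ) :=
  congrArg (fun φ => φ.hom δ) ((E.map c.op).naturality a)

end Bifunctor

variable [Preadditive C] [HasZeroObject C] [HasBinaryBiproducts C] (T : Extriangulation.{w} C)

theorem extPush_zero_hom {D A A' : C} (δ : (T.E.obj (Opposite.op D)).obj A) :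
    extPush T.E (0 : A ⟶ A') δ = 0 := by
  have := T.additive_right (Opposite.op D)
  simp [extPush]

theorem exists_realization {D A : C} (δ : (T.E.obj (Opposite.op D)).obj A) :
    ∃ (B : C) (x : A ⟶ B) (y : B ⟶ D), T.s δ = seqClass x y := by
  obtain ⟨⟨B, x, y⟩, h⟩ := Quotient.exists_rep (s := twoStepSetoid A D) (T.s δ)
  exact ⟨B, x, y, h.symm⟩

section Realization

variable {T} {A B D : C} {x : A ⟶ B} {y : B ⟶ D} {δ : (T.E.obj (Opposite.op D)).obj A}

theorem extPush_inflation (h : T.s δ = seqClass x y) : extPush T.E x δ = 0 := by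
  obtain ⟨c, hc, -⟩ := T.et3 x y _ _ δ 0 h (T.s_zero B (0 : C)) x biprod.inl rfl
  simpa using hc

theorem extPull_deflation (h : T.s δ = seqClass x y) : extPull T.E y δ = 0 := by
  obtain ⟨a, ha, -⟩ := T.et3_op _ _ x y 0 δ (T.s_zero (0 : C) B) h biprod.snd y rfl
  simpa using ha.symm

theorem exists_lift_of_extPull_eq_zero (h : T.s δ = seqClass x y) {Z : C} (g : Z ⟶ D)
    (hg : extPull T.E g δ = 0) : ∃ q : Z ⟶ B, q ≫ y = g := by
  obtain ⟨b, -, hb⟩ := T.realization _ _ x y 0 δ (T.s_zero A Z) h (𝟙 A) g (by simp [hg])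
  exact ⟨biprod.inr ≫ b, by simp [← hb]⟩

theorem exists_desc_of_extPush_eq_zero (h : T.s δ = seqClass x y) {Z : C} (g : A ⟶ Z)
    (hg : extPush T.E g δ = 0) : ∃ q : B ⟶ Z, x ≫ q = g := by
  obtain ⟨b, hb, -⟩ := T.realization x y _ _ δ 0 h (T.s_zero Z D) g (𝟙 D) (by simp [hg])
  exact ⟨b ≫ biprod.fst, by simp [reassoc_of% hb]⟩

theorem exists_factor_inflation (h : T.s δ = seqClass x y) {Z : C} (f : Z ⟶ B) (hf : f ≫ y = 0) :
    ∃ t : Z ⟶ A, t ≫ x = f := by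
  obtain ⟨a, -, ha⟩ := T.et3_op _ _ x y 0 δ (T.s_zero Z (0 : C)) h (biprod.fst ≫ f) 0
    (by simp [hf])
  exact ⟨a, by simp [← ha]⟩

theorem exists_factor_deflation (h : T.s δ = seqClass x y) {Z : C} (f : B ⟶ Z) (hf : x ≫ f = 0) :
    ∃ t : D ⟶ Z, y ≫ t = f := by
  obtain ⟨c, -, hc⟩ := T.et3 x y _ _ δ 0 h (T.s_zero (0 : C) Z) 0 (f ≫ biprod.inr)
    (by simp [reassoc_of% hf])
  exact ⟨c, by simp [hc]⟩

theorem realizes_extPull_iso (h : T.s δ = seqClass x y) {D' : C} (c : D' ≅ D) :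
    T.s (extPull T.E c.hom δ) = seqClass x (y ≫ c.inv) := by
  obtain ⟨B', x', y', h'⟩ := T.exists_realization (extPull T.E c.hom δ)
  obtain ⟨b, hb₁, hb₂⟩ := T.realization x' y' x y _ δ h' h (𝟙 A) c.hom (by simp)
  simp only [Category.id_comp] at hb₁
  obtain ⟨f, hf⟩ := exists_lift_of_extPull_eq_zero h' (y ≫ c.inv) (by
    rw [← extPull_comp, Category.assoc, c.inv_hom_id, Category.comp_id, extPull_deflation h])
  obtain ⟨t, ht⟩ := exists_factor_inflation h (𝟙 B - f ≫ b) (by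
    rw [Preadditive.sub_comp, Category.assoc, ← hb₂, reassoc_of% hf]; simp)
  have hx' : extPush T.E x' δ = 0 := by
    have h₀ := extPush_inflation h'
    rw [← extPull_extPush] at h₀
    have h₁ := congrArg (extPull T.E c.inv) h₀
    simpa [← extPull_comp] using h₁
  obtain ⟨r, hr⟩ := exists_desc_of_extPush_eq_zero h x' hx'
  obtain ⟨t', ht'⟩ := exists_factor_deflation h' (𝟙 B' - b ≫ r) (by
    rw [Preadditive.comp_sub, reassoc_of% hb₁, hr]; simp)
  have hepi : (f + t ≫ x') ≫ b = 𝟙 B := by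
    rw [Preadditive.add_comp, Category.assoc, hb₁, ht]; abel
  have hy' : y' = b ≫ y ≫ c.inv := by rw [← reassoc_of% hb₂]; simp
  have hmono : b ≫ (r + y ≫ c.inv ≫ t') = 𝟙 B' := by
    rw [Preadditive.comp_add]
    have : b ≫ y ≫ c.inv ≫ t' = y' ≫ t' := by rw [hy']; simp
    rw [this, ht']; abel
  have hinv : f + t ≫ x' = r + y ≫ c.inv ≫ t' := by
    rw [← Category.comp_id (f + t ≫ x'), ← hmono, reassoc_of% hepi]
  rw [h']
  exact seqClass_eq ⟨b, f + t ≫ x', by rw [hinv, hmono], hepi⟩ hb₁ hy'.symm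

end Realization

section Conflation

variable {T}

theorem Conflation.comp_iso {A B D D' : C} {x : A ⟶ B} {y : B ⟶ D} (h : T.Conflation x y)
    (e : D ≅ D') : T.Conflation x (y ≫ e.hom) := by
  obtain ⟨δ, h⟩ := h
  exact ⟨_, realizes_extPull_iso h e.symm⟩

variable (T)

theorem conflation_inl_snd (A D : C) :
    T.Conflation (biprod.inl : A ⟶ A ⊞ D) (biprod.snd : A ⊞ D ⟶ D) :=
  ⟨0, T.s_zero A D⟩

theorem realizes_inr_fst (A D : C) :
    T.s (0 : (T.E.obj (Opposite.op A)).obj D) =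
      seqClass (biprod.inr : D ⟶ A ⊞ D) (biprod.fst : A ⊞ D ⟶ A) :=
  (T.s_zero D A).trans (seqClass_eq (biprod.braiding D A) (by ext <;> simp) (by simp))

theorem conflation_inr_fst (A D : C) :
    T.Conflation (biprod.inr : D ⟶ A ⊞ D) (biprod.fst : A ⊞ D ⟶ A) :=
  ⟨0, T.realizes_inr_fst A D⟩

theorem conflation_zero_id (A : C) : T.Conflation (0 : (0 : C) ⟶ A) (𝟙 A) :=
  ⟨0, (T.s_zero (0 : C) A).trans
    (seqClass_eq ⟨biprod.snd, biprod.inr, by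
        refine biprod.hom_ext' _ _ ((isZero_zero C).eq_of_src _ _) (by simp), by simp⟩
      (by simp) (by simp))⟩

variable {T}

theorem Conflation.biprod {A B D A' B' D' : C} {x : A ⟶ B} {y : B ⟶ D} {x' : A' ⟶ B'}
    {y' : B' ⟶ D'} (h : T.Conflation x y) (h' : T.Conflation x' y') :
    T.Conflation (biprod.map x x') (biprod.map y y') := by
  obtain ⟨δ, h⟩ := h
  obtain ⟨δ', h'⟩ := h'
  exact ⟨_, T.s_sum _ _ _ _ _ _ h h'⟩

/-- The composite of two deflations is a deflation, and its kernel is an extension. -/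
theorem Conflation.comp {D A B F G : C} {f' : D ⟶ A} {f : A ⟶ B} {g' : F ⟶ B} {g : B ⟶ G}
    (h : T.Conflation f' f) (h' : T.Conflation g' g) :
    ∃ (H : C) (i : H ⟶ A) (d : D ⟶ H) (e : H ⟶ F),
      T.Conflation i (f ≫ g) ∧ T.Conflation d e := by
  obtain ⟨δ, h⟩ := h
  obtain ⟨δ', h'⟩ := h'
  obtain ⟨H, i, d, e, δ'', -, -, h₁, h₂, -, -⟩ := T.et4_op f' f g' g δ δ' h h'
  exact ⟨H, i, d, e, ⟨_, h₁⟩, ⟨_, h₂⟩⟩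

theorem conflation_of_realizes_add {A₁ A₂ B₁ D M : C} {x₁ : A₁ ⟶ B₁} {y₁ : B₁ ⟶ D}
    {δ₁ : (T.E.obj (Opposite.op D)).obj A₁} {δ : (T.E.obj (Opposite.op D)).obj (A₁ ⊞ A₂)}
    {x : A₁ ⊞ A₂ ⟶ M} {y : M ⟶ D} (h₁ : T.s δ₁ = seqClass x₁ y₁) (h : T.s δ = seqClass x y)
    (hδ : extPush T.E biprod.fst δ = δ₁) :
    ∃ (i : A₂ ⟶ M) (p : M ⟶ B₁), T.Conflation i p := by
  obtain ⟨H, h', d, e, δ'', -, -, hH, hde, -, -⟩ :=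
    T.et4 _ _ x y 0 δ (T.realizes_inr_fst A₁ A₂) h
  rw [hδ, h₁] at hde
  obtain ⟨b, -, -⟩ := exists_iso_of_seqClass_eq hde
  exact ⟨_, _, Conflation.comp_iso ⟨_, hH⟩ b.symm⟩

/-- The pullback of two deflations with the same target. -/
theorem Conflation.pullback {A₁ B₁ A₂ B₂ D : C} {x₁ : A₁ ⟶ B₁} {y₁ : B₁ ⟶ D} {x₂ : A₂ ⟶ B₂}
    {y₂ : B₂ ⟶ D} (h₁ : T.Conflation x₁ y₁) (h₂ : T.Conflation x₂ y₂) :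
    ∃ (M : C) (i₂ : A₂ ⟶ M) (p₁ : M ⟶ B₁) (i₁ : A₁ ⟶ M) (p₂ : M ⟶ B₂),
      T.Conflation i₂ p₁ ∧ T.Conflation i₁ p₂ := by
  obtain ⟨δ₁, h₁⟩ := h₁
  obtain ⟨δ₂, h₂⟩ := h₂
  obtain ⟨M, x, y, h⟩ := T.exists_realization
    (extPush T.E (biprod.inl : A₁ ⟶ A₁ ⊞ A₂) δ₁ + extPush T.E (biprod.inr : A₂ ⟶ A₁ ⊞ A₂) δ₂)
  obtain ⟨i₂, p₁, hp₁⟩ := conflation_of_realizes_add h₁ h (by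
    rw [extPush_add, ← extPush_comp, ← extPush_comp]; simp [extPush_zero_hom])
  obtain ⟨H, h', d, e, δ'', -, -, hH, hde, -, -⟩ :=
    T.et4 _ _ x y 0 _ (T.s_zero A₁ A₂) h
  rw [extPush_add, ← extPush_comp, ← extPush_comp] at hde
  simp only [BinaryBicone.inl_snd, BinaryBicone.inr_snd, extPush_zero_hom, extPush_id,
    zero_add, h₂] at hde
  obtain ⟨b, -, -⟩ := exists_iso_of_seqClass_eq hde
  exact ⟨M, i₂, p₁, _, _, hp₁, Conflation.comp_iso ⟨_, hH⟩ b.symm⟩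

end Conflation

/-- Every extension in `E(Z, Y)` is zero. -/
def ExtZero (Z Y : C) : Prop := ∀ δ : (T.E.obj (Opposite.op Z)).obj Y, δ = 0

section ExtZero

variable {T} {A B D Z Y : C} {x : A ⟶ B} {y : B ⟶ D}

theorem ExtZero.exists_desc (h : T.ExtZero D Y) (hxy : T.Conflation x y) (f : A ⟶ Y) :
    ∃ q : B ⟶ Y, x ≫ q = f := by
  obtain ⟨δ, hδ⟩ := hxy
  exact exists_desc_of_extPush_eq_zero hδ f (h _)

theorem ExtZero.exists_lift (h : T.ExtZero Z A) (hxy : T.Conflation x y) (f : Z ⟶ D) :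
    ∃ q : Z ⟶ B, q ≫ y = f := by
  obtain ⟨δ, hδ⟩ := hxy
  exact exists_lift_of_extPull_eq_zero hδ f (h _)

theorem ExtZero.nonempty_iso (h : T.ExtZero D A) (hxy : T.Conflation x y) :
    Nonempty (B ≅ A ⊞ D) := by
  obtain ⟨δ, hδ⟩ := hxy
  rw [h δ, T.s_zero] at hδ
  obtain ⟨e, -, -⟩ := exists_iso_of_seqClass_eq hδ
  exact ⟨e.symm⟩

theorem extZero_of_isSplitEpi (H : ∀ ⦃B : C⦄ (x : A ⟶ B) (y : B ⟶ D), T.Conflation x y →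
    ∃ σ : D ⟶ B, σ ≫ y = 𝟙 D) : T.ExtZero D A := by
  intro δ
  obtain ⟨B, x, y, h⟩ := T.exists_realization δ
  obtain ⟨σ, hσ⟩ := H x y ⟨δ, h⟩
  rw [← extPull_id T.E δ, ← hσ, extPull_comp, extPull_deflation h, extPull_zero]

theorem extZero_of_lift (hxy : T.Conflation x y) (hB : T.ExtZero Z B)
    (H : ∀ f : Z ⟶ D, ∃ q : Z ⟶ B, q ≫ y = f) : T.ExtZero Z A := by
  intro ε
  obtain ⟨δ, hδ⟩ := hxy
  obtain ⟨B', x', y', h'⟩ := T.exists_realization ε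
  obtain ⟨b, hb⟩ := exists_desc_of_extPush_eq_zero h' x (hB _)
  obtain ⟨c, hc, -⟩ := T.et3 x' y' x y ε δ h' hδ (𝟙 A) b (by simpa using hb)
  obtain ⟨q, rfl⟩ := H c
  rwa [extPush_id, extPull_comp, extPull_deflation hδ, extPull_zero] at hc

theorem extZero_of_desc (hxy : T.Conflation x y) (hB : T.ExtZero B Y)
    (H : ∀ f : A ⟶ Y, ∃ q : B ⟶ Y, x ≫ q = f) : T.ExtZero D Y := by
  intro ε
  obtain ⟨δ, hδ⟩ := hxy
  obtain ⟨B', x', y', h'⟩ := T.exists_realization ε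
  obtain ⟨b, hb⟩ := exists_lift_of_extPull_eq_zero h' y (hB _)
  obtain ⟨a, ha, -⟩ := T.et3_op x y x' y' δ ε hδ h' b (𝟙 D) (by simpa using hb.symm)
  obtain ⟨q, rfl⟩ := H a
  rw [extPull_id, extPush_comp, extPush_inflation hδ, extPush_zero] at ha
  exact ha.symm

theorem IsEProjective.extZero {P : C} (hP : T.IsEProjective P) : T.ExtZero P Y :=
  extZero_of_isSplitEpi fun _ x y h => hP x y h (𝟙 P)

theorem IsEInjective.extZero {I : C} (hI : T.IsEInjective I) : T.ExtZero Z I := by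
  intro δ
  obtain ⟨B, x, y, h⟩ := T.exists_realization δ
  obtain ⟨q, hq⟩ := hI x y ⟨δ, h⟩ (𝟙 I)
  rw [← extPush_id T.E δ, ← hq, extPush_comp, extPush_inflation h, extPush_zero]

end ExtZero

end Extriangulation

namespace Extriangulation

variable {C : Type u} [Category.{v} C] [Preadditive C] [HasZeroObject C] [HasBinaryBiproducts C]
  {T : Extriangulation.{w} C}

section DimensionShift

theorem extZero_iff_of_conflations {K P Z Y I D : C} {x : K ⟶ P} {y : P ⟶ Z} {i : Y ⟶ I}
    {p : I ⟶ D} (hP : T.IsEProjective P) (hxy : T.Conflation x y) (hI : T.IsEInjective I)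
    (hip : T.Conflation i p) : T.ExtZero Z D ↔ T.ExtZero K Y := by
  constructor
  · intro h
    refine extZero_of_lift hip hI.extZero fun f => ?_
    obtain ⟨q, rfl⟩ := h.exists_desc hxy f
    obtain ⟨r, rfl⟩ := hP i p hip q
    exact ⟨x ≫ r, by simp⟩
  · intro h
    refine extZero_of_desc hxy hP.extZero fun f => ?_
    obtain ⟨q, rfl⟩ := h.exists_lift hip f
    obtain ⟨r, rfl⟩ := hI x y hxy q
    exact ⟨r ≫ p, by simp⟩

theorem exists_conflation_cosyzygy (hi : T.EnoughEInjectives) (Y : C) :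
    ∃ (I : C) (x : Y ⟶ I) (y : I ⟶ T.cosyzygy hi Y), T.IsEInjective I ∧ T.Conflation x y :=
  (hi Y).choose_spec

theorem cosyzygyIter_succ' (hi : T.EnoughEInjectives) (k : ℕ) (Y : C) :
    T.cosyzygyIter hi (k + 1) Y = T.cosyzygyIter hi k (T.cosyzygy hi Y) := by
  induction k with
  | zero => rfl
  | succ k ih => exact congrArg (T.cosyzygy hi) ih

theorem exists_syzygy_extZero_iff (hp : T.EnoughEProjectives) (hi : T.EnoughEInjectives) (k : ℕ)
    (Z : C) : ∃ Z' : C, ∀ Y : C, T.ExtZero Z (T.cosyzygyIter hi k Y) ↔ T.ExtZero Z' Y := by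
  induction k generalizing Z with
  | zero => exact ⟨Z, fun _ => Iff.rfl⟩
  | succ k ih =>
    obtain ⟨K, P, x, y, hP, hxy⟩ := hp Z
    obtain ⟨Z', hZ'⟩ := ih K
    refine ⟨Z', fun Y => ?_⟩
    obtain ⟨I, i, p, hI, hip⟩ := exists_conflation_cosyzygy hi (T.cosyzygyIter hi k Y)
    exact (extZero_iff_of_conflations hP hxy hI hip).trans (hZ' Y)

theorem extZero_of_conflation (hp : T.EnoughEProjectives) (hi : T.EnoughEInjectives)
    {A B D Z : C} {x : A ⟶ B} {y : B ⟶ D} (hxy : T.Conflation x y) (hB : T.ExtZero Z B)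
    (hA : T.ExtZero Z (T.cosyzygy hi A)) : T.ExtZero Z D := by
  obtain ⟨K, P, x', y', hP, hxy'⟩ := hp Z
  obtain ⟨I, i, p, hI, hip⟩ := exists_conflation_cosyzygy hi A
  rw [extZero_iff_of_conflations hP hxy' hI hip] at hA
  refine extZero_of_desc hxy' hP.extZero fun f => ?_
  obtain ⟨q, rfl⟩ := hA.exists_lift hxy f
  obtain ⟨r, rfl⟩ := hB.exists_desc hxy' q
  exact ⟨r ≫ y, by simp⟩

theorem extZero_iff_subsingleton {Z Y : C} :
    T.ExtZero Z Y ↔ Subsingleton ((T.E.obj (Opposite.op Z)).obj Y) :=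
  (subsingleton_iff_forall_eq 0).symm

theorem subsingleton_higherExt_enough_iff (hp : T.EnoughEProjectives) (hi : T.EnoughEInjectives)
    (k : ℕ) (Z Y : C) : Subsingleton (higherExt (.enough hp hi : T.HigherExtData) (k + 1) Z Y) ↔
      T.ExtZero Z (T.cosyzygyIter hi k Y) := by
  rw [extZero_iff_subsingleton]
  exact Equiv.ulift.subsingleton_congr

end DimensionShift

theorem extZero_of_subsingleton_higherExt (h : T.HigherExtData) {Z Y : C}
    (hs : Subsingleton (higherExt h 1 Z Y)) : T.ExtZero Z Y := by
  cases h with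
  | abelian hk hc hm he hconf =>
    let _ : HasFiniteProducts C := hasFiniteProducts_of_has_binary_and_terminal
    let _ : Abelian C := {}
    have _ : HasExt.{max u v} C := HasExt.standard C
    have hs' : Subsingleton (Abelian.Ext.{max u v} Z Y 1) :=
      Equiv.ulift.{w}.symm.subsingleton_congr.2 hs
    refine extZero_of_isSplitEpi fun B x y hxy => ?_
    obtain ⟨hz, hS⟩ := (hconf x y).1 hxy
    obtain ⟨σ, hσ⟩ := Abelian.Ext.covariant_sequence_exact₃ Z hS (n₀ := 0) (n₁ := 1)
      (Abelian.Ext.mk₀ (𝟙 Z)) rfl (Subsingleton.elim _ _)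
    obtain ⟨σ, rfl⟩ := Abelian.Ext.homEquiv₀.symm.surjective σ
    refine ⟨σ, (Abelian.Ext.mk₀_bijective Z Z).1 ?_⟩
    simpa using hσ
  | triangulated φ φ_push φ_pull hr =>
    rw [extZero_iff_subsingleton]
    exact (φ Z Y).toEquiv.subsingleton_congr.2 (Equiv.ulift.symm.subsingleton_congr.2 hs)
  | enough hp hi => exact (subsingleton_higherExt_enough_iff hp hi 0 Z Y).1 hs

theorem subsingleton_higherExt_of_conflation (h : T.HigherExtData) {k : ℕ} (hk : 1 ≤ k)
    {A B D : C} {x : A ⟶ B} {y : B ⟶ D} (hxy : T.Conflation x y) {Z : C}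
    (hB : Subsingleton (higherExt h k Z B)) (hA : Subsingleton (higherExt h (k + 1) Z A)) :
    Subsingleton (higherExt h k Z D) := by
  cases h with
  | abelian hk hc hm he hconf =>
    let _ : HasFiniteProducts C := hasFiniteProducts_of_has_binary_and_terminal
    let _ : Abelian C := {}
    have _ : HasExt.{max u v} C := HasExt.standard C
    have hA' : Subsingleton (Abelian.Ext.{max u v} Z A (k + 1)) :=
      Equiv.ulift.{w}.symm.subsingleton_congr.2 hA
    have hB' : Subsingleton (Abelian.Ext.{max u v} Z B k) :=
      Equiv.ulift.{w}.symm.subsingleton_congr.2 hB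
    suffices Subsingleton (Abelian.Ext.{max u v} Z D k) from
      Equiv.ulift.{w}.subsingleton_congr.2 this
    obtain ⟨hz, hS⟩ := (hconf x y).1 hxy
    refine (subsingleton_iff_forall_eq 0).2 fun ε => ?_
    obtain ⟨β, rfl⟩ := Abelian.Ext.covariant_sequence_exact₃ Z hS ε rfl (Subsingleton.elim _ _)
    rw [Subsingleton.elim β 0, Abelian.Ext.zero_comp]
  | triangulated φ φ_push φ_pull hr =>
    obtain ⟨δ, hδ⟩ := hxy
    have hT := Pretriangulated.Triangle.shift_distinguished _ ((hr x y δ).1 hδ) (k : ℤ)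
    have hA' : Subsingleton (Z ⟶ (shiftFunctor C ((k + 1 : ℕ) : ℤ)).obj A) :=
      Equiv.ulift.symm.subsingleton_congr.2 hA
    have hB' : Subsingleton (Z ⟶ (shiftFunctor C (k : ℤ)).obj B) :=
      Equiv.ulift.symm.subsingleton_congr.2 hB
    suffices Subsingleton (Z ⟶ (shiftFunctor C (k : ℤ)).obj D) from
      Equiv.ulift.subsingleton_congr.2 this
    have hA'' : Subsingleton
        (Z ⟶ (shiftFunctor C (1 : ℤ)).obj ((shiftFunctor C (k : ℤ)).obj A)) :=
      (((shiftFunctorAdd' C (k : ℤ) 1 ((k + 1 : ℕ) : ℤ) (by simp)).app A).homToEquiv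
        ).subsingleton_congr.1 hA'
    refine (subsingleton_iff_forall_eq 0).2 fun f => ?_
    obtain ⟨g, hg⟩ := Pretriangulated.Triangle.coyoneda_exact₃ _ hT f (hA''.elim _ _)
    rw [hg, hB'.elim g 0]
    exact zero_comp
  | enough hp hi =>
    obtain ⟨k, rfl⟩ := Nat.exists_eq_add_of_le' hk
    rw [subsingleton_higherExt_enough_iff] at hA hB ⊢
    obtain ⟨Z', hZ'⟩ := exists_syzygy_extZero_iff hp hi k Z
    rw [cosyzygyIter_succ', hZ'] at hA
    rw [hZ'] at hB ⊢
    exact extZero_of_conflation hp hi hxy hB hA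

theorem relIdObj_eq_zero_iff (h : T.HigherExtData) (𝒳 : ObjectProperty C) (M : C) :
    relIdObj h 𝒳 M = 0 ↔ ExtVanishesFrom h 1 𝒳 (fun N => N = M) := by
  refine ⟨fun h0 => ?_, fun h1 => ?_⟩
  · have hlt : relIdObj h 𝒳 M < 1 := by rw [h0]; exact zero_lt_one
    simp only [relIdObj, iInf_lt_iff] at hlt
    obtain ⟨m, hm, hlt⟩ := hlt
    obtain rfl : m = 0 := by simpa using hlt
    exact hm
  · exact le_antisymm (iInf₂_le 0 h1) zero_le

theorem relPdObj_eq_zero_iff (h : T.HigherExtData) (𝒳 : ObjectProperty C) (M : C) :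
    relPdObj h 𝒳 M = 0 ↔ ExtVanishesFrom h 1 (fun N => N = M) 𝒳 := by
  refine ⟨fun h0 => ?_, fun h1 => ?_⟩
  · have hlt : relPdObj h 𝒳 M < 1 := by rw [h0]; exact zero_lt_one
    simp only [relPdObj, iInf_lt_iff] at hlt
    obtain ⟨m, hm, hlt⟩ := hlt
    obtain rfl : m = 0 := by simpa using hlt
    exact hm
  · exact le_antisymm (iInf₂_le 0 h1) zero_le

theorem relId_eq_zero_iff (h : T.HigherExtData) (𝒳 𝒴 : ObjectProperty C) :
    relId h 𝒳 𝒴 = 0 ↔ ExtVanishesFrom h 1 𝒳 𝒴 := by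
  simp only [relId, ← bot_eq_zero, iSup_eq_bot]
  simp only [bot_eq_zero, relIdObj_eq_zero_iff]
  exact ⟨fun H k hk X Y hX hY => H Y hY k hk X Y hX rfl,
    fun H Y hY k hk X Y' hX hY' => H k hk X Y' hX (hY' ▸ hY)⟩

theorem relPd_eq_zero_iff (h : T.HigherExtData) (𝒳 𝒴 : ObjectProperty C) :
    relPd h 𝒳 𝒴 = 0 ↔ ExtVanishesFrom h 1 𝒴 𝒳 := by
  simp only [relPd, ← bot_eq_zero, iSup_eq_bot]
  simp only [bot_eq_zero, relPdObj_eq_zero_iff]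
  exact ⟨fun H k hk X Y hX hY => H X hX k hk X Y rfl hY,
    fun H X hX k hk X' Y hX' hY => H k hk X' Y (hX' ▸ hX) hY⟩

end Extriangulation

namespace Extriangulation

open scoped ZeroObject

variable {C : Type u} [Category.{v} C] [Preadditive C] [HasZeroObject C] [HasBinaryBiproducts C]
  {T : Extriangulation.{w} C} {ω ν 𝒳 𝒮 : ObjectProperty C}

/-- The isomorphism of `A` with its biproduct with the zero object. -/
noncomputable def isoBiprodZeroObj (A : C) : A ≅ A ⊞ (0 : C) where
  hom := biprod.inl
  inv := biprod.fst
  inv_hom_id := biprod.hom_ext' _ _ (by simp) ((isZero_zero C).eq_of_src _ _)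

theorem _root_.CategoryTheory.ObjectProperty.ClosedUnderSummands.of_iso
    (hω : ω.ClosedUnderSummands) {A B : C} (e : A ≅ B) (hA : ω A) : ω B :=
  hω ⟨e ≪≫ isoBiprodZeroObj B⟩ hA

theorem ClosedUnderExtensions.biprod (hω : T.ClosedUnderExtensions ω) {A B : C} (hA : ω A)
    (hB : ω B) : ω (A ⊞ B) :=
  hω _ _ (T.conflation_inl_snd A B) hA hB

theorem HasResolution.of_iso {n : ℕ} {M N : C} (h : T.HasResolution ω n M) (e : M ≅ N) :
    T.HasResolution ω n N := by
  cases h with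
  | zero hX e' => exact .zero hX (e' ≪≫ e)
  | succ x y hxy hX hK => exact .succ x (y ≫ e.hom) (hxy.comp_iso e) hX hK

theorem HasResolution.mono (hle : ν ≤ ω) {n : ℕ} {M : C} (h : T.HasResolution ν n M) :
    T.HasResolution ω n M := by
  induction h with
  | zero hX e => exact .zero (hle _ hX) e
  | succ x y hxy hX _ ih => exact .succ x y hxy (hle _ hX) ih

theorem le_hat : ω ≤ T.hat ω := fun M hM => ⟨0, .zero hM (Iso.refl M)⟩

theorem hat_mono (hle : ν ≤ ω) : T.hat ν ≤ T.hat ω := fun _ ⟨n, h⟩ => ⟨n, h.mono hle⟩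

theorem ClosedUnderCones.of_iso (hc : T.ClosedUnderCones 𝒮) (hcc : T.ClosedUnderCocones 𝒮)
    {A B : C} (e : A ≅ B) (hA : 𝒮 A) : 𝒮 B := by
  have h₁ := (T.conflation_zero_id A).comp_iso e
  have h₀ : 𝒮 (0 : C) := hcc _ _ (T.conflation_zero_id A) hA hA
  exact hc _ _ h₁ h₀ hA

theorem HasResolution.of_closedUnderCones (hc : T.ClosedUnderCones 𝒮)
    (hcc : T.ClosedUnderCocones 𝒮) {n : ℕ} {M : C} (h : T.HasResolution (ω ⊓ 𝒮) n M) : 𝒮 M := by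
  induction h with
  | zero hX e => exact hc.of_iso hcc e hX.2
  | succ x y hxy hX _ ih => exact hc x y hxy ih hX.2

section Generator

variable (hext : T.ClosedUnderExtensions ω) (hsum : ω.ClosedUnderSummands)
  (hgen : T.IsRelGenerator ν ω)

include hsum

theorem hasResolution_zero_iff {M : C} : T.HasResolution ω 0 M ↔ ω M :=
  ⟨fun h => by cases h with | zero hX e => exact hsum.of_iso e hX, fun h => .zero h (Iso.refl M)⟩

include hgen

theorem HasResolution.succ_of_generator {n : ℕ} {M : C} (h : T.HasResolution ω n M) :
    T.HasResolution ω (n + 1) M := by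
  induction h with
  | zero hX e =>
    obtain ⟨W', V, x, y, hxy, hV, hW'⟩ := hgen.2 _ (hsum.of_iso e hX)
    exact .succ x y hxy (hgen.1 _ hV) (.zero hW' (Iso.refl _))
  | succ x y hxy hX _ ih => exact .succ x y hxy hX ih

theorem HasResolution.of_le {m n : ℕ} (hmn : m ≤ n) {M : C} (h : T.HasResolution ω m M) :
    T.HasResolution ω n M := by
  induction hmn with
  | refl => exact h
  | step _ ih => exact ih.succ_of_generator hsum hgen

omit hgen
include hext

theorem HasResolution.of_extension_of_left_mem {n : ℕ} {A B D : C} {x : A ⟶ B} {y : B ⟶ D}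
    (hxy : T.Conflation x y) (hA : ω A) (hD : T.HasResolution ω n D) :
    T.HasResolution ω n B := by
  cases hD with
  | zero hX e =>
    exact .zero (hext x y hxy hA (hsum.of_iso e hX)) (Iso.refl B)
  | succ x' y' hxy' hX hK =>
    obtain ⟨P, i₂, p₁, i₁, p₂, h₁, h₂⟩ := hxy.pullback hxy'
    exact .succ i₂ p₁ h₁ (hext _ _ h₂ hA hX) hK

include hgen

/-- Objects with an `ω`-resolution can be covered by objects of a relative generator of `ω`. -/
theorem HasResolution.exists_cover {n : ℕ} {M : C} (h : T.HasResolution ω (n + 1) M) :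
    ∃ (K V : C) (x : K ⟶ V) (y : V ⟶ M), T.Conflation x y ∧ ν V ∧ T.HasResolution ω n K := by
  cases h with
  | succ x y hxy hX hK =>
    obtain ⟨W', V, x', y', hxy', hV, hW'⟩ := hgen.2 _ hX
    obtain ⟨H, i, d, e, hi, hde⟩ := hxy'.comp hxy
    exact ⟨H, V, i, _, hi, hV, .of_extension_of_left_mem hext hsum hde hW' hK⟩

theorem hat_exists_cover {M : C} (h : T.hat ω M) :
    ∃ (K V : C) (x : K ⟶ V) (y : V ⟶ M), T.Conflation x y ∧ ν V ∧ T.hat ω K := by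
  obtain ⟨n, h⟩ := h
  obtain ⟨K, V, x, y, hxy, hV, hK⟩ :=
    (h.succ_of_generator hsum hgen).exists_cover hext hsum hgen
  exact ⟨K, V, x, y, hxy, hV, n, hK⟩

variable (hν : ∀ ⦃V M : C⦄, ν V → T.hat ω M → T.ExtZero V M)
include hν

theorem HasResolution.of_extension {n : ℕ} {A B D : C} {x : A ⟶ B} {y : B ⟶ D}
    (hxy : T.Conflation x y) (hA : T.HasResolution ω n A) (hD : T.HasResolution ω n D) :
    T.HasResolution ω n B := by
  induction n generalizing A B D with
  | zero =>
    rw [hasResolution_zero_iff hsum] at hA hD ⊢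
    exact hext x y hxy hA hD
  | succ n ih =>
    obtain ⟨K, V, i, p, hip, hV, hK⟩ := hA.exists_cover hext hsum hgen
    obtain ⟨K', V', i', p', hip', hV', hK'⟩ := hD.exists_cover hext hsum hgen
    obtain ⟨P, i₂, p₁, i₁, p₂, h₁, h₂⟩ := hxy.pullback hip'
    obtain ⟨e⟩ := (hν hV' ⟨_, hA⟩).nonempty_iso h₂
    obtain ⟨H, j, d, q, hj, hdq⟩ :=
      ((hip.biprod (T.conflation_zero_id V')).comp_iso e.symm).comp h₁
    exact .succ j _ hj (hext.biprod (hgen.1 _ hV) (hgen.1 _ hV'))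
      (ih hdq (hK.of_iso (isoBiprodZeroObj K)) hK')

theorem HasResolution.of_summand {n : ℕ} {M N : C} (h : T.HasResolution ω n (M ⊞ N)) :
    T.HasResolution ω n M := by
  induction n generalizing M N with
  | zero =>
    rw [hasResolution_zero_iff hsum] at h ⊢
    exact hsum ⟨Iso.refl _⟩ h
  | succ n ih =>
    obtain ⟨K, V, x, y, hxy, hV, hK⟩ := h.exists_cover hext hsum hgen
    obtain ⟨H, j, -, -, hj, -⟩ := hxy.comp (T.conflation_inr_fst M N)
    obtain ⟨H', j', -, -, hj', -⟩ := hxy.comp (T.conflation_inl_snd M N)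
    have hVω := hgen.1 _ hV
    have hVV := hext.biprod hVω hVω
    have hb := hj.biprod hj'
    obtain ⟨P, i₂, p₁, i₁, p₂, h₁, h₂⟩ := hb.pullback hxy
    have hP : T.HasResolution ω n P := .of_extension hext hsum hgen hν h₁ hK
      (.of_le hsum hgen (Nat.zero_le n) (.zero hVV (Iso.refl _)))
    have hlift : ∀ f : V ⟶ M ⊞ N, ∃ q : V ⟶ V, q ≫ y = f :=
      fun f => (hν hV ⟨n, hK⟩).exists_lift hxy f
    have hz : T.ExtZero V (H ⊞ H') := extZero_of_lift hb (hν hV (le_hat _ hVV)) fun f => by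
      obtain ⟨q, hq⟩ := hlift (f ≫ biprod.fst ≫ biprod.inl)
      obtain ⟨q', hq'⟩ := hlift (f ≫ biprod.snd ≫ biprod.inr)
      exact ⟨biprod.lift q q', by ext <;> simp [reassoc_of% hq, reassoc_of% hq']⟩
    obtain ⟨e⟩ := hz.nonempty_iso h₂
    exact .succ j _ hj hVω (ih (hP.of_iso (e ≪≫ biprod.associator H H' V)))

theorem hat_closedUnderExtensions : T.ClosedUnderExtensions (T.hat ω) := by
  rintro A B D x y hxy ⟨m, hA⟩ ⟨n, hD⟩
  exact ⟨max m n, .of_extension hext hsum hgen hν hxy (hA.of_le hsum hgen (le_max_left _ _))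
    (hD.of_le hsum hgen (le_max_right _ _))⟩

theorem hat_closedUnderSummands : (T.hat ω).ClosedUnderSummands := by
  rintro M A B ⟨e⟩ ⟨n, hM⟩
  exact ⟨n, .of_summand hext hsum hgen hν (hM.of_iso e)⟩

theorem hat_closedUnderCones : T.ClosedUnderCones (T.hat ω) := by
  intro A B D x y hxy hA hB
  obtain ⟨K, V, i, p, hip, hV, hK⟩ := hat_exists_cover hext hsum hgen hB
  obtain ⟨H, j, d, e, hj, hde⟩ := hip.comp hxy
  obtain ⟨n, hH⟩ := hat_closedUnderExtensions hext hsum hgen hν d e hde hK hA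
  exact ⟨n + 1, .succ j _ hj (hgen.1 _ hV) hH⟩

theorem hat_isRightThick : T.IsRightThick (T.hat ω) :=
  ⟨hat_closedUnderExtensions hext hsum hgen hν, hat_closedUnderSummands hext hsum hgen hν,
    hat_closedUnderCones hext hsum hgen hν⟩

end Generator

theorem hat_inf_eq (hext : T.ClosedUnderExtensions ω) (hsum : ω.ClosedUnderSummands)
    (hgen : T.IsRelGenerator (ω ⊓ 𝒮) ω) (hc : T.ClosedUnderCones 𝒮)
    (hcc : T.ClosedUnderCocones 𝒮) : T.hat ω ⊓ 𝒮 = T.hat (ω ⊓ 𝒮) := by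
  refine le_antisymm ?_ fun M hM => ⟨hat_mono inf_le_left _ hM, ?_⟩
  · rintro M ⟨⟨n, hM⟩, hS⟩
    refine ⟨n, ?_⟩
    induction n generalizing M with
    | zero => exact .zero ⟨(hasResolution_zero_iff hsum).1 hM, hS⟩ (Iso.refl M)
    | succ n ih =>
      obtain ⟨K, V, x, y, hxy, hV, hK⟩ := hM.exists_cover hext hsum hgen
      exact .succ x y hxy hV (ih K (hcc x y hxy hV.2 hS) hK)
  · obtain ⟨n, hM⟩ := hM
    exact hM.of_closedUnderCones hc hcc

theorem ExtVanishesFrom.hat {h : T.HigherExtData} (hv : ExtVanishesFrom h 1 𝒳 ω)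
    (hsum : ω.ClosedUnderSummands) : ExtVanishesFrom h 1 𝒳 (T.hat ω) := by
  rintro k hk X M hX ⟨n, hM⟩
  induction hM generalizing k with
  | zero hW e => exact hv k hk X _ hX (hsum.of_iso e hW)
  | succ x y hxy hW _ ih =>
    exact subsingleton_higherExt_of_conflation h hk hxy (hv k hk X _ hX hW)
      (ih (k + 1) (Nat.le_succ_of_le hk))

theorem ExtVanishesFrom.extZero {h : T.HigherExtData} (hv : ExtVanishesFrom h 1 𝒳 ω) ⦃X W : C⦄
    (hX : 𝒳 X) (hW : ω W) : T.ExtZero X W :=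
  extZero_of_subsingleton_higherExt h (hv 1 le_rfl X W hX hW)

namespace IsLeftFrobenius

variable {h : T.HigherExtData} (hF : IsLeftFrobenius h 𝒳 ω)
include hF

theorem extVanishes_hat : ExtVanishesFrom h 1 𝒳 (T.hat ω) :=
  ExtVanishesFrom.hat ((relId_eq_zero_iff h 𝒳 ω).1 hF.injective) hF.summands

theorem inf_hat_eq : 𝒳 ⊓ T.hat ω = ω := by
  refine le_antisymm ?_ fun M hM => ⟨hF.cogenerator.1 _ hM, le_hat _ hM⟩
  rintro M ⟨hM, hM'⟩
  obtain ⟨W, X', x, y, hxy, hW, hX'⟩ := hF.cogenerator.2 M hM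
  exact hF.summands ((hF.extVanishes_hat.extZero hX' hM').nonempty_iso hxy) hW

theorem isRelGenerator_self : T.IsRelGenerator ω ω :=
  ⟨le_rfl, fun W hW => ⟨0, W, 0, 𝟙 W, T.conflation_zero_id W, hW,
    hF.summands ⟨isoBiprodZeroObj W ≪≫ biprod.braiding W 0⟩ hW⟩⟩

end IsLeftFrobenius

namespace IsCutLeftFrobenius

variable {h : T.HigherExtData} (hF : IsCutLeftFrobenius h 𝒮 𝒳 ω)
include hF

theorem extVanishes_hat : ExtVanishesFrom h 1 (ω ⊓ 𝒮) (T.hat ω) :=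
  ExtVanishesFrom.hat ((relPd_eq_zero_iff h _ _).1 hF.projective) hF.summands

theorem inf_closedUnderExtensions : T.ClosedUnderExtensions (ω ⊓ 𝒮) := fun _ _ _ x y hxy hA hD =>
  have hle := hF.frobenius.cogenerator.1
  ⟨hF.extensions x y hxy hA.1 hD.1, (hF.frobenius.leftThick.1 x y hxy (hle _ hA) (hle _ hD)).2⟩

variable (hc : T.ClosedUnderCones 𝒮) (hcc : T.ClosedUnderCocones 𝒮)
include hc hcc

theorem hat_inf_eq : T.hat ω ⊓ 𝒮 = T.hat (ω ⊓ 𝒮) :=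
  Extriangulation.hat_inf_eq hF.extensions hF.summands hF.generator hc hcc

theorem inf_hat_inf_eq : 𝒳 ⊓ T.hat ω ⊓ 𝒮 = ω ⊓ 𝒮 := by
  rw [← hF.frobenius.inf_hat_eq, ← hF.hat_inf_eq hc hcc]
  exact inf_inf_distrib_right _ _ _

theorem isCutLeftWeakABContext : IsCutLeftWeakABContext h 𝒮 𝒳 (T.hat ω) where
  frobenius :=
    { leftThick := hF.leftThick
      frobenius := by
        rw [hF.inf_hat_inf_eq hc hcc]
        exact hF.frobenius
      projective := by
        rw [hF.inf_hat_inf_eq hc hcc, relPd_eq_zero_iff]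
        exact fun k hk X Y hX hY => hF.extVanishes_hat k hk X Y hX hY.2
      generator := by
        rw [hF.inf_hat_inf_eq hc hcc]
        refine ⟨fun W hW => ⟨(hF.frobenius.cogenerator.1 _ hW).1, le_hat _ hW.1⟩, ?_⟩
        rintro M ⟨hM, hM'⟩
        obtain ⟨K, V, x, y, hxy, hV, hK⟩ :=
          hat_exists_cover hF.extensions hF.summands hF.generator hM'
        exact ⟨K, V, x, y, hxy, hV,
          hF.leftThick.2.2 x y hxy (hF.frobenius.cogenerator.1 _ hV).1 hM, hK⟩
      extensions := fun _ _ _ x y hxy hA hD =>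
        ⟨hF.leftThick.1 x y hxy hA.1 hD.1,
          hat_closedUnderExtensions hF.extensions hF.summands hF.generator
            hF.extVanishes_hat.extZero x y hxy hA.2 hD.2⟩
      summands := fun _ _ _ e hM =>
        ⟨hF.leftThick.2.1 e hM.1,
          hat_closedUnderSummands hF.extensions hF.summands hF.generator
            hF.extVanishes_hat.extZero e hM.2⟩ }
  rightThick := by
    rw [hF.hat_inf_eq hc hcc]
    exact hat_isRightThick hF.inf_closedUnderExtensions hF.frobenius.summands
      hF.frobenius.isRelGenerator_self fun V M hV hM =>
        hF.frobenius.extVanishes_hat.extZero (hF.frobenius.cogenerator.1 _ hV) hM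
  le_hat := by
    rw [hF.hat_inf_eq hc hcc]
    exact hat_mono hF.frobenius.cogenerator.1

end IsCutLeftFrobenius

end Extriangulation

theorem theorem3p8 {C : Type u} [Category.{v} C] [Preadditive C] [HasZeroObject C]
    [HasBinaryBiproducts C] (T : Extriangulation.{w} C) (h : T.HigherExtData)
    (S : ObjectProperty C) (hcones : T.ClosedUnderCones S) (hcocones : T.ClosedUnderCocones S) :
    ∃ Φ : Quotient (Extriangulation.cutFrobeniusSetoid h S) ≃
        Quotient (Extriangulation.cutABSetoid h S),
      (∀ (X ω : ObjectProperty C) (hXω : Extriangulation.IsCutLeftFrobenius h S X ω),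
        ∃ hΦ : Extriangulation.IsCutLeftWeakABContext h S X (T.hat ω),
          Φ ⟦⟨X, ω, hXω⟩⟧ = ⟦⟨X, T.hat ω, hΦ⟩⟧) ∧
      (∀ (A B : ObjectProperty C) (hAB : Extriangulation.IsCutLeftWeakABContext h S A B),
        ∃ hΨ : Extriangulation.IsCutLeftFrobenius h S A (A ⊓ B),
          Φ.symm ⟦⟨A, B, hAB⟩⟧ = ⟦⟨A, A ⊓ B, hΨ⟩⟧) := by
  refine ⟨⟨Quotient.map (fun p => ⟨p.fst, T.hat p.snd,
      p.prop.isCutLeftWeakABContext hcones hcocones⟩) fun p q hpq => ⟨hpq.1, ?_⟩,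
    Quotient.map (fun p => ⟨p.fst, p.fst ⊓ p.snd, p.prop.frobenius⟩) fun p q hpq => hpq,
    ?_, ?_⟩, fun X ω hXω => ⟨hXω.isCutLeftWeakABContext hcones hcocones, rfl⟩,
    fun A B hAB => ⟨hAB.frobenius, rfl⟩⟩
  · rw [p.prop.inf_hat_inf_eq hcones hcocones, q.prop.inf_hat_inf_eq hcones hcocones]
    exact hpq.2
  · rintro ⟨p⟩
    exact Quotient.sound ⟨rfl, p.prop.inf_hat_inf_eq hcones hcocones⟩
  · rintro ⟨p⟩
    exact Quotient.sound ⟨rfl, p.prop.frobenius.inf_hat_inf_eq hcones hcocones⟩
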